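/- Let $n\ge 1$ be an integer and let $\delta>0$. Let $S_\delta$ be the Steklov class: the set of probability measures $\mu$ on the unit circle $\mathbb{T}=\{e^{i\theta}:-\pi<\theta\le\pi\}$ whose density $\mu'$ (the Radon--Nikodym derivative with respect to $d\theta$ of the absolutely continuous part of $\mu$) satisfies $\mu'(\theta)\ge \delta/(2\pi)$ for almost every $\theta$. For $\mu\in S_\delta$ let $\phi_n(z;\mu)$ denote the $n$-th orthonormal polynomial of $\mu$: the unique polynomial of degree $n$ with positive leading coefficient such that $\int \phi_n(e^{i\theta};\mu)\,e^{-ij\theta}\,d\mu(\theta)=0$ for $0\le j<n$ and $\int|\phi_n(e^{i\theta};\mu)|^2\,d\mu(\theta)=1$. **Theorem.** If $\mu^*\in S_\delta$ is a maximizer, i.e. $|\phi_n(1;\mu^*)|=\max_{\mu\in S_\delta}|\phi_n(1;\mu)|$, then $\mu^*$ can be written in the form $$d\mu^*=\frac{\delta}{2\pi}\,d\theta+\sum_{j=1}^N m_j\,\delta(\theta-\theta_j),\qquad 1\le N\le n,$$ where $\delta(\theta-\theta_j)$ is the unit point mass at $e^{i\theta_j}$, $m_j\ge 0$ for all $j$,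 and $-\pi<\theta_1<\dots<\theta_N\le\pi$. -/

import Mathlib

open MeasureTheory Polynomial
open scoped Real ComplexConjugate

noncomputable section

/-- The unit circle `𝕋`, parametrized by the angle `θ ∈ ℝ / 2πℤ`. Its `volume` is the measure `dθ`,
of total mass `2π`, and `AddCircle.toCircle θ` is the point `e^{iθ}`. -/
abbrev UnitCirc : Type := AddCircle (2 * π)

instance twoPiPosFact : Fact (0 < 2 * π) := ⟨Real.two_pi_pos⟩

/-- The Steklov class `S_δ`: the probability measures `σ` on the unit circle whose density `σ'`
(the Radon-Nikodym derivative of the absolutely continuous part of `σ` with respect to `dθ`)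
satisfies `σ' ≥ δ / (2π)` almost everywhere. -/
def steklovClass (δ : ℝ) : Set (Measure UnitCirc) :=
  {σ | IsProbabilityMeasure σ ∧
    ∀ᵐ θ ∂(volume : Measure UnitCirc), ENNReal.ofReal (δ / (2 * π)) ≤ σ.rnDeriv volume θ}

/-- The inner product `⟨p, q⟩_μ = ∫ p(e^{iθ}) conj(q(e^{iθ})) dμ(θ)` of two polynomials. -/
def circInner (μ : Measure UnitCirc) (p q : ℂ[X]) : ℂ :=
  ∫ θ : UnitCirc, p.eval (AddCircle.toCircle θ : ℂ) *
    conj (q.eval (AddCircle.toCircle θ : ℂ)) ∂μ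

/-- `p` is an `n`-th orthonormal polynomial of `μ`: it has degree `n` and a positive leading
coefficient, is orthogonal to `1, z, …, z^{n-1}`, and has norm `1` in `L²(μ)`. -/
structure IsOrthonormalPoly (μ : Measure UnitCirc) (n : ℕ) (p : ℂ[X]) : Prop where
  natDegree_eq : p.natDegree = n
  leadingCoeff_pos : ∃ c : ℝ, 0 < c ∧ p.leadingCoeff = (c : ℂ)
  orthogonal : ∀ j < n, circInner μ p (X ^ j) = 0
  norm_one : circInner μ p p = 1

open Classical in
/-- The orthonormal polynomial `φ_n(·; μ)`. It exists and is unique whenever `μ` is a finite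
measure with infinite support, in particular for every `μ` in a Steklov class `S_δ`, `δ > 0`. -/
def orthonormalPoly (μ : Measure UnitCirc) (n : ℕ) : ℂ[X] :=
  if h : ∃ p, IsOrthonormalPoly μ n p then h.choose else 0

end

/-! The Steklov class is convex, so a maximizer `μ` satisfies a first order condition along each
segment from `μ` to `σ`. Let `p` be the orthonormal polynomial of `μ`, `a` the kernel reproducing
values at 1 in degree less than `n`, and `Q = conj (p 1) • p + a` the kernel in degree at most `n`.
The derivative of `|φ_n(1)|²` at `μ` in the direction `σ - μ` is `-∫ U d(σ - μ)`, where `U = |Q|² -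
|a|²`; thus `μ` minimizes `∫ U dσ` over the class (`first_variation_nonneg`).

Comparison with the measure that moves all of `ν = μ - (δ/2π) dθ` to one minimum point of `U` shows
that `ν` lives on the minimum set of `U`. Now `U - min U` is a nonnegative trigonometric polynomial
of degree exactly `n`, because `Q` has nonzero coefficients of orders `n` and 0. Its zeros on the
circle are at least double, so there are at most `n` of them (`card_minimizers_le`). -/

/-! ### Sesquilinearity of the inner product. -/

theorem continuous_eval_toCircle (p : ℂ[X]) :
    Continuous fun θ : UnitCirc => p.eval (AddCircle.toCircle θ : ℂ) :=
  p.continuous.comp (continuous_subtype_val.comp AddCircle.continuous_toCircle)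

theorem Continuous.integrable_unitCirc {E : Type*} [NormedAddCommGroup E]
    (μ : Measure UnitCirc) [IsFiniteMeasure μ]
    {f : UnitCirc → E} (hf : Continuous f) : Integrable f μ :=
  hf.integrable_of_hasCompactSupport (HasCompactSupport.of_compactSpace f)

theorem integrable_circInner (μ : Measure UnitCirc) [IsFiniteMeasure μ] (p q : ℂ[X]) :
    Integrable (fun θ : UnitCirc => p.eval (AddCircle.toCircle θ : ℂ) *
      conj (q.eval (AddCircle.toCircle θ : ℂ))) μ :=
  ((continuous_eval_toCircle p).mul
    (Complex.continuous_conj.comp (continuous_eval_toCircle q))).integrable_unitCirc μ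

section
variable (μ : Measure UnitCirc) (p q r : ℂ[X]) (c : ℂ)

theorem circInner_conj_symm : conj (circInner μ p q) = circInner μ q p := by
  unfold circInner
  rw [← integral_conj]
  simp only [map_mul, Complex.conj_conj, mul_comm]

theorem circInner_smul_left : circInner μ (c • p) r = c * circInner μ p r := by
  unfold circInner
  rw [← integral_const_mul]
  simp only [eval_smul, smul_eq_mul, mul_assoc]

theorem circInner_smul_right : circInner μ p (c • r) = conj c * circInner μ p r := by
  rw [← circInner_conj_symm, circInner_smul_left, map_mul, circInner_conj_symm]

theorem circInner_zero_left : circInner μ 0 r = 0 := by simp [circInner]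

theorem circInner_self :
    circInner μ p p = ((∫ θ : UnitCirc, ‖p.eval (AddCircle.toCircle θ : ℂ)‖ ^ 2 ∂μ : ℝ) : ℂ) := by
  unfold circInner
  refine Eq.trans (integral_congr_ae (.of_forall fun θ => ?_)) integral_ofReal
  simp only [Complex.mul_conj, Complex.normSq_eq_norm_sq]
  rfl

theorem circInner_self_re :
    (circInner μ p p).re = ∫ θ : UnitCirc, ‖p.eval (AddCircle.toCircle θ : ℂ)‖ ^ 2 ∂μ := by
  rw [circInner_self, Complex.ofReal_re]

theorem circInner_self_eq_re : circInner μ p p = ((circInner μ p p).re : ℂ) := by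
  rw [circInner_self, Complex.ofReal_re]

theorem circInner_self_re_nonneg : 0 ≤ (circInner μ p p).re := by
  rw [circInner_self_re]
  exact integral_nonneg fun θ => by positivity

variable [IsFiniteMeasure μ]

theorem circInner_add_left : circInner μ (p + q) r = circInner μ p r + circInner μ q r := by
  unfold circInner
  rw [← integral_add (integrable_circInner μ p r) (integrable_circInner μ q r)]
  simp only [eval_add, add_mul]

theorem circInner_add_right : circInner μ p (q + r) = circInner μ p q + circInner μ p r := by
  rw [← circInner_conj_symm, circInner_add_left, map_add, circInner_conj_symm,
    circInner_conj_symm]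

theorem circInner_sub_left : circInner μ (p - q) r = circInner μ p r - circInner μ q r := by
  rw [sub_eq_add_neg, ← neg_one_smul ℂ q, circInner_add_left, circInner_smul_left]; ring

theorem circInner_sub_right : circInner μ p (q - r) = circInner μ p q - circInner μ p r := by
  rw [← circInner_conj_symm, circInner_sub_left, map_sub, circInner_conj_symm,
    circInner_conj_symm]

end

theorem circInner_re (μ : Measure UnitCirc) [IsFiniteMeasure μ] (p q : ℂ[X]) :
    (circInner μ p q).re = ∫ θ : UnitCirc, (p.eval (AddCircle.toCircle θ : ℂ) *
      conj (q.eval (AddCircle.toCircle θ : ℂ))).re ∂μ :=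
  (integral_re (integrable_circInner μ p q)).symm

/-! ### Definiteness for measures dominating a multiple of `dθ`. -/

theorem eq_zero_of_ae_eval_eq_zero (p : ℂ[X])
    (h : ∀ᵐ θ : UnitCirc, p.eval (AddCircle.toCircle θ : ℂ) = 0) : p = 0 := by
  have h0 : (fun θ : UnitCirc => p.eval (AddCircle.toCircle θ : ℂ)) = fun _ => 0 :=
    ((continuous_eval_toCircle p).ae_eq_iff_eq volume continuous_const).1 h
  have : Infinite (Set.Ioc (-π) (-π + 2 * π)) :=
    (Set.Ioc_infinite (by linarith [Real.pi_pos])).to_subtype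
  have : Infinite UnitCirc :=
    Infinite.of_injective _ (AddCircle.equivIoc (2 * π) (-π)).symm.injective
  apply Polynomial.eq_zero_of_infinite_isRoot
  refine (Set.infinite_range_of_injective (f := fun θ : UnitCirc => (AddCircle.toCircle θ : ℂ))
    (Subtype.val_injective.comp (AddCircle.injective_toCircle Real.two_pi_pos.ne'))).mono ?_
  rintro _ ⟨θ, rfl⟩
  exact congrFun h0 θ

theorem ae_volume_of_ae {μ : Measure UnitCirc} {c : ENNReal} (hc : c ≠ 0)
    (hμ : c • (volume : Measure UnitCirc) ≤ μ) {P : UnitCirc → Prop} (h : ∀ᵐ θ ∂μ, P θ) :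
    ∀ᵐ θ : UnitCirc, P θ :=
  (Measure.absolutelyContinuous_smul hc).ae_le ((Measure.absolutelyContinuous_of_le hμ).ae_le h)

theorem eq_zero_of_circInner_self {μ : Measure UnitCirc} [IsFiniteMeasure μ] {c : ENNReal}
    (hc : c ≠ 0) (hμ : c • (volume : Measure UnitCirc) ≤ μ) {p : ℂ[X]}
    (h : (circInner μ p p).re = 0) : p = 0 := by
  rw [circInner_self_re] at h
  replace h := (integral_eq_zero_iff_of_nonneg (fun θ => sq_nonneg _)
    (((continuous_eval_toCircle p).norm.pow 2).integrable_unitCirc μ)).1 h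
  apply eq_zero_of_ae_eval_eq_zero
  filter_upwards [ae_volume_of_ae hc hμ h] with θ hθ
  simpa using hθ

/-- A polynomial whose squared modulus has zero integral against `1 - Re z` vanishes. -/
theorem eq_zero_of_circInner_eq_zero {μ : Measure UnitCirc} [IsFiniteMeasure μ] {c : ENNReal}
    (hc : c ≠ 0) (hμ : c • (volume : Measure UnitCirc) ≤ μ) {p q r : ℂ[X]}
    (hpq : ∀ z : Circle, (p.eval (z : ℂ) * conj (q.eval (z : ℂ))).re
      = (1 - (z : ℂ).re) * ‖r.eval (z : ℂ)‖ ^ 2)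
    (h : (circInner μ p q).re = 0) : r = 0 := by
  rw [circInner_re] at h
  have hi : Integrable (fun θ : UnitCirc => (p.eval (AddCircle.toCircle θ : ℂ) *
      conj (q.eval (AddCircle.toCircle θ : ℂ))).re) μ := (integrable_circInner μ p q).re
  have hz (z : Circle) : 0 ≤ 1 - (z : ℂ).re := by
    have := Complex.re_le_norm (z : ℂ)
    rw [Circle.norm_coe] at this
    linarith
  replace h := (integral_eq_zero_iff_of_nonneg (fun θ => by
    simp only [hpq, Pi.zero_apply]; exact mul_nonneg (hz _) (by positivity)) hi).1 h
  -- On the circle `1 - Re z` vanishes only at `z = 1`; the factor `X - 1` absorbs that point.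
  have h1 : (X - 1) * r = 0 := by
    apply eq_zero_of_ae_eval_eq_zero
    filter_upwards [ae_volume_of_ae hc hμ h] with θ hθ
    simp only [hpq, Pi.zero_apply, mul_eq_zero] at hθ
    simp only [eval_mul, eval_sub, eval_X, eval_one, mul_eq_zero]
    rcases hθ with hθ | hθ
    · left
      have h2 : (AddCircle.toCircle θ : ℂ).re = 1 := by linarith
      have h3 := Complex.normSq_apply (AddCircle.toCircle θ : ℂ)
      rw [Complex.normSq_eq_norm_sq, Circle.norm_coe, h2] at h3
      apply Complex.ext
      · simp [h2]
      · have : (AddCircle.toCircle θ : ℂ).im = 0 := by nlinarith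
        simp [this]
    · right
      simpa using hθ
  rcases mul_eq_zero.1 h1 with h | h
  · exact absurd h (by simpa using X_sub_C_ne_zero (1 : ℂ))
  · exact h

/-! ### Convexity of the Steklov class. -/

/-- Domination of measures replaces the density bound: convexity becomes immediate, and adding any
positive measure preserves it. -/
theorem mem_steklovClass_iff {δ : ℝ} {σ : Measure UnitCirc} :
    σ ∈ steklovClass δ ↔ IsProbabilityMeasure σ ∧
      ENNReal.ofReal (δ / (2 * π)) • (volume : Measure UnitCirc) ≤ σ := by
  refine and_congr_right fun hσ => ⟨fun h => ?_, fun h => ?_⟩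
  · calc _ = volume.withDensity (fun _ => ENNReal.ofReal (δ / (2 * π))) := by
          rw [withDensity_const]
      _ ≤ volume.withDensity (σ.rnDeriv volume) := withDensity_mono h
      _ ≤ σ := Measure.withDensity_rnDeriv_le _ _
  · set τ := ENNReal.ofReal (δ / (2 * π)) • (volume : Measure UnitCirc) with hτ
    have : IsFiniteMeasure τ := isFiniteMeasure_of_le σ h
    have : IsFiniteMeasure (σ - τ) := inferInstance
    have h1 := Measure.rnDeriv_add' (σ - τ) τ (volume : Measure UnitCirc)
    rw [Measure.sub_add_cancel_of_le h] at h1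
    have h2 := Measure.rnDeriv_smul_left_of_ne_top' (volume : Measure UnitCirc) (volume : Measure UnitCirc)
      (r := ENNReal.ofReal (δ / (2 * π))) ENNReal.ofReal_ne_top
    filter_upwards [h1, h2, Measure.rnDeriv_self (volume : Measure UnitCirc)] with θ h1 h2 h3
    rw [h1, Pi.add_apply, hτ, h2, Pi.smul_apply, h3]
    simp

theorem circInner_convex_comb (μ σ : Measure UnitCirc) [IsFiniteMeasure μ] [IsFiniteMeasure σ]
    {t : ℝ} (h0 : 0 ≤ t) (h1 : t ≤ 1) (p q : ℂ[X]) :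
    circInner (ENNReal.ofReal (1 - t) • μ + ENNReal.ofReal t • σ) p q
      = (1 - t) * circInner μ p q + t * circInner σ p q := by
  unfold circInner
  rw [integral_add_measure ((integrable_circInner μ p q).smul_measure ENNReal.ofReal_ne_top)
    ((integrable_circInner σ p q).smul_measure ENNReal.ofReal_ne_top), integral_smul_measure,
    integral_smul_measure, ENNReal.toReal_ofReal h0, ENNReal.toReal_ofReal (by linarith)]
  simp

theorem steklovClass_convex_comb {δ t : ℝ} (h0 : 0 ≤ t) (h1 : t ≤ 1)
    {μ σ : Measure UnitCirc} (hμ : μ ∈ steklovClass δ) (hσ : σ ∈ steklovClass δ) :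
    ENNReal.ofReal (1 - t) • μ + ENNReal.ofReal t • σ ∈ steklovClass δ := by
  rw [mem_steklovClass_iff] at *
  obtain ⟨_, hμ⟩ := hμ
  obtain ⟨_, hσ⟩ := hσ
  have h : ENNReal.ofReal (1 - t) + ENNReal.ofReal t = 1 := by
    rw [← ENNReal.ofReal_add (by linarith) h0]; simp
  refine ⟨⟨by simp [h]⟩, ?_⟩
  set τ := ENNReal.ofReal (δ / (2 * π)) • (volume : Measure UnitCirc)
  calc τ = ENNReal.ofReal (1 - t) • τ + ENNReal.ofReal t • τ := by rw [← add_smul, h, one_smul]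
    _ ≤ _ := by gcongr

/-! ### Hilbert space structure on polynomials of bounded degree. -/

section
variable {μ : Measure UnitCirc} [IsFiniteMeasure μ] {c : ENNReal}

/-- The inner product of `L²(μ)` on the polynomials of degree less than `k`. -/
noncomputable abbrev circInnerCore (hc : c ≠ 0) (hμ : c • (volume : Measure UnitCirc) ≤ μ) (k : ℕ) :
    InnerProductSpace.Core ℂ (degreeLT ℂ k) where
  -- The arguments are swapped because `inner` is conjugate-linear in its first argument.
  inner p q := circInner μ (q : ℂ[X]) p
  conj_inner_symm p q := circInner_conj_symm μ _ _
  re_inner_nonneg p := circInner_self_re_nonneg μ _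
  add_left p q r := circInner_add_right μ _ _ _
  smul_left p q a := circInner_smul_right μ _ _ _
  definite p h := Subtype.ext (eq_zero_of_circInner_self hc hμ (by rw [h]; rfl))

theorem exists_circInner_representer (hc : c ≠ 0) (hμ : c • (volume : Measure UnitCirc) ≤ μ)
    (k : ℕ) (L : ℂ[X] →ₗ[ℂ] ℂ) :
    ∃ a ∈ degreeLT ℂ k, ∀ w ∈ degreeLT ℂ k, circInner μ w a = L w := by
  let core := circInnerCore hc hμ k
  let : NormedAddCommGroup (degreeLT ℂ k) := core.toNormedAddCommGroup
  let : InnerProductSpace ℂ (degreeLT ℂ k) := InnerProductSpace.ofCore core.toCore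
  have : FiniteDimensional ℂ (degreeLT ℂ k) := (degreeLTEquiv ℂ k).symm.finiteDimensional
  have : CompleteSpace (degreeLT ℂ k) := FiniteDimensional.complete ℂ _
  let f := LinearMap.toContinuousLinearMap (L ∘ₗ (degreeLT ℂ k).subtype)
  refine ⟨((InnerProductSpace.toDual ℂ (degreeLT ℂ k)).symm f : degreeLT ℂ k), Subtype.prop _,
    fun w hw => ?_⟩
  exact InnerProductSpace.toDual_symm_apply (x := (⟨w, hw⟩ : degreeLT ℂ k)) (y := f)

/-- In finite dimension the inclusion into `C(UnitCirc, ℂ)` is bounded. This turns `L²(μ)` bounds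
into sup bounds, which control integrals against any other `σ`. -/
theorem exists_norm_eval_sq_le (hc : c ≠ 0) (hμ : c • (volume : Measure UnitCirc) ≤ μ) (k : ℕ) :
    ∃ C : ℝ, 0 ≤ C ∧ ∀ p ∈ degreeLT ℂ k, ∀ θ : UnitCirc,
      ‖p.eval (AddCircle.toCircle θ : ℂ)‖ ^ 2 ≤ C * (circInner μ p p).re := by
  let core := circInnerCore hc hμ k
  let : NormedAddCommGroup (degreeLT ℂ k) := core.toNormedAddCommGroup
  let : InnerProductSpace ℂ (degreeLT ℂ k) := InnerProductSpace.ofCore core.toCore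
  have : FiniteDimensional ℂ (degreeLT ℂ k) := (degreeLTEquiv ℂ k).symm.finiteDimensional
  let f : degreeLT ℂ k →ₗ[ℂ] C(UnitCirc, ℂ) :=
    { toFun := fun p => ⟨_, continuous_eval_toCircle (p : ℂ[X])⟩
      map_add' := fun p q => by ext θ; simp
      map_smul' := fun a p => by ext θ; simp }
  let F := LinearMap.toContinuousLinearMap f
  refine ⟨‖F‖ ^ 2, by positivity, fun p hp θ => ?_⟩
  let P : degreeLT ℂ k := ⟨p, hp⟩
  have h1 : ‖p.eval (AddCircle.toCircle θ : ℂ)‖ ≤ ‖F P‖ := (F P).norm_coe_le_norm θ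
  have h2 : ‖P‖ ^ 2 = (circInner μ p p).re := norm_sq_eq_re_inner (𝕜 := ℂ) P
  rw [← h2, ← mul_pow]
  exact pow_le_pow_left₀ (norm_nonneg _) (h1.trans (F.le_opNorm P)) 2

end

/-! ### Orthonormal polynomials. -/

section
variable {μ : Measure UnitCirc} [IsFiniteMeasure μ]

theorem circInner_eq_zero_of_mem_degreeLT {n : ℕ} {p w : ℂ[X]}
    (hp : ∀ j < n, circInner μ p (X ^ j) = 0) (hw : w ∈ degreeLT ℂ n) : circInner μ w p = 0 := by
  rw [degreeLT_eq_span_X_pow] at hw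
  induction hw using Submodule.span_induction with
  | mem x hx =>
    obtain ⟨j, hj, rfl⟩ := by simpa using hx
    rw [← circInner_conj_symm, hp j hj, map_zero]
  | zero => exact circInner_zero_left μ p
  | add x y _ _ hx hy => rw [circInner_add_left, hx, hy, add_zero]
  | smul a x _ hx => rw [circInner_smul_left, hx, mul_zero]

theorem exists_isOrthonormalPoly {c : ENNReal} (hc : c ≠ 0)
    (hμ : c • (volume : Measure UnitCirc) ≤ μ) (n : ℕ) : ∃ p, IsOrthonormalPoly μ n p := by
  -- Here `a` is the orthogonal projection of `X ^ n` onto lower degrees (Gram–Schmidt).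
  obtain ⟨a, ha, h⟩ := exists_circInner_representer hc hμ n
    { toFun := fun w => circInner μ w (X ^ n)
      map_add' := fun p q => circInner_add_left μ p q _
      map_smul' := fun b p => circInner_smul_left μ p _ b }
  rw [mem_degreeLT] at ha
  set q : ℂ[X] := X ^ n - a with hq
  have hm : q.Monic := (monic_X_pow n).sub_of_left (by rwa [degree_X_pow])
  have hd : q.natDegree = n := natDegree_eq_of_degree_eq_some (by
    rw [hq, degree_sub_eq_left_of_degree_lt (by simpa using ha), degree_X_pow])
  have ho : ∀ j < n, circInner μ q (X ^ j) = 0 := fun j hj => by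
    have := h (X ^ j) (by rw [mem_degreeLT, degree_X_pow]; exact_mod_cast hj)
    simp only [LinearMap.coe_mk, AddHom.coe_mk] at this
    rw [← circInner_conj_symm, hq, circInner_sub_right, this, sub_self, map_zero]
  have hpos : 0 < (circInner μ q q).re := lt_of_le_of_ne (circInner_self_re_nonneg μ q)
    fun h0 => hm.ne_zero (eq_zero_of_circInner_self hc hμ h0.symm)
  set s := √((circInner μ q q).re)
  have hs : 0 < s := Real.sqrt_pos.2 hpos
  refine ⟨((s⁻¹ : ℝ) : ℂ) • q, ?_, ⟨s⁻¹, inv_pos.2 hs, ?_⟩, fun j hj => ?_, ?_⟩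
  · rw [natDegree_smul _ (by exact_mod_cast (inv_pos.2 hs).ne'), hd]
  · rw [smul_eq_C_mul, leadingCoeff_mul, leadingCoeff_C, hm.leadingCoeff, mul_one]
  · rw [circInner_smul_left, ho j hj, mul_zero]
  · rw [circInner_smul_left, circInner_smul_right, circInner_self_eq_re, Complex.conj_ofReal]
    norm_cast
    rw [← Real.sq_sqrt hpos.le]
    change s⁻¹ * (s⁻¹ * s ^ 2) = 1
    field_simp

theorem isOrthonormalPoly_orthonormalPoly {c : ENNReal} (hc : c ≠ 0)
    (hμ : c • (volume : Measure UnitCirc) ≤ μ) (n : ℕ) :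
    IsOrthonormalPoly μ n (orthonormalPoly μ n) := by
  have h := exists_isOrthonormalPoly hc hμ n
  rw [orthonormalPoly, dif_pos h]
  exact h.choose_spec

theorem IsOrthonormalPoly.eval_one_ne_zero {c : ENNReal} (hc : c ≠ 0)
    (hμ : c • (volume : Measure UnitCirc) ≤ μ) {n : ℕ} {p : ℂ[X]} (hp : IsOrthonormalPoly μ n p) :
    p.eval 1 ≠ 0 := by
  intro h
  have hp0 : p ≠ 0 := by
    rintro rfl
    simpa [circInner_zero_left] using hp.norm_one
  obtain ⟨r, hr⟩ := dvd_iff_isRoot.2 h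
  have hr0 : r ≠ 0 := by rintro rfl; exact hp0 (by rw [hr, mul_zero])
  -- With `p = (X - 1) r`, the real part of `-r · conj p` on the circle is `(1 - Re z)|r|²`, while
  -- `r` has degree less than `n` and so is orthogonal to `p`.
  refine hr0 (eq_zero_of_circInner_eq_zero hc hμ (p := (-1 : ℂ) • r) (q := p) (fun z => ?_) ?_)
  · simp only [hr, eval_smul, eval_mul, eval_sub, eval_X, smul_eq_mul, map_mul, map_sub,
      map_one, ← Complex.normSq_eq_norm_sq, Complex.normSq_apply]
    simp
    ring
  · rw [circInner_smul_left, circInner_eq_zero_of_mem_degreeLT hp.orthogonal]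
    · simp
    · have := natDegree_mul (X_sub_C_ne_zero (1 : ℂ)) hr0
      rw [← hr, hp.natDegree_eq, natDegree_X_sub_C] at this
      exact mem_degreeLT.2 (degree_le_natDegree.trans_lt (by exact_mod_cast (by omega)))

end

/-! ### The first variation. -/

theorem norm_circInner_le (σ : Measure UnitCirc) [IsProbabilityMeasure σ] {p q : ℂ[X]} {A B : ℝ}
    (hp : ∀ θ : UnitCirc, ‖p.eval (AddCircle.toCircle θ : ℂ)‖ ≤ A)
    (hq : ∀ θ : UnitCirc, ‖q.eval (AddCircle.toCircle θ : ℂ)‖ ≤ B) :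
    ‖circInner σ p q‖ ≤ A * B := by
  have h := norm_integral_le_of_norm_le_const (μ := σ) (C := A * B)
    (f := fun θ : UnitCirc => p.eval (AddCircle.toCircle θ : ℂ) *
      conj (q.eval (AddCircle.toCircle θ : ℂ))) (.of_forall fun θ => by
        rw [norm_mul, RCLike.norm_conj]
        exact mul_le_mul (hp θ) (hq θ) (norm_nonneg _) ((norm_nonneg _).trans (hp θ)))
  simpa [circInner] using h

theorem IsOrthonormalPoly.mem_degreeLT {μ : Measure UnitCirc} {n : ℕ} {p : ℂ[X]}
    (hp : IsOrthonormalPoly μ n p) : p ∈ degreeLT ℂ (n + 1) :=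
  Polynomial.mem_degreeLT.2 (degree_le_natDegree.trans_lt
    (by rw [hp.natDegree_eq]; exact_mod_cast n.lt_succ_self))

theorem IsOrthonormalPoly.coeff_eq {μ : Measure UnitCirc} {n : ℕ} {p : ℂ[X]}
    (hp : IsOrthonormalPoly μ n p) : ∃ c : ℝ, 0 < c ∧ p.coeff n = c := by
  have := hp.leadingCoeff_pos
  rwa [leadingCoeff, hp.natDegree_eq] at this

theorem mem_degreeLT_of_coeff_eq_zero {n : ℕ} {p : ℂ[X]} (hp : p ∈ degreeLT ℂ (n + 1))
    (h : p.coeff n = 0) : p ∈ degreeLT ℂ n := by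
  rw [mem_degreeLT, degree_lt_iff_coeff_zero] at *
  intro m hm
  rcases hm.eq_or_lt with rfl | hm
  · exact h
  · exact hp m hm

/-- Matching the leading coefficient of the maximizer's polynomial makes the perturbation of lower
degree, hence orthogonal to that polynomial in `L²(μ)`. Maximality then reads as a bound on
`|P(1)|²` relative to the squared norm of `P`. -/
theorem exists_rescaled_orthonormalPoly {n : ℕ} {δ : ℝ} (hδ : 0 < δ) {μ σ : Measure UnitCirc}
    (hσ : σ ∈ steklovClass δ)
    (hmax : IsMaxOn (fun σ : Measure UnitCirc => ‖(orthonormalPoly σ n).eval 1‖)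
      (steklovClass δ) μ)
    (hp : IsOrthonormalPoly μ n (orthonormalPoly μ n)) :
    ∃ P : ℂ[X], P - orthonormalPoly μ n ∈ degreeLT ℂ n ∧
      (∀ w ∈ degreeLT ℂ n, circInner σ P w = 0) ∧
      ‖P.eval 1‖ ^ 2 ≤ ‖(orthonormalPoly μ n).eval 1‖ ^ 2 * (circInner σ P P).re := by
  have hle := hmax hσ
  obtain ⟨_, hσ⟩ := mem_steklovClass_iff.1 hσ
  have hq := isOrthonormalPoly_orthonormalPoly (c := ENNReal.ofReal (δ / (2 * π)))
    (by simpa using by positivity) hσ n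
  set p := orthonormalPoly μ n
  set q := orthonormalPoly σ n
  obtain ⟨a, ha, hpa⟩ := hp.coeff_eq
  obtain ⟨b, hb, hqb⟩ := hq.coeff_eq
  refine ⟨((a / b : ℝ) : ℂ) • q, ?_, fun w hw => ?_, ?_⟩
  · refine mem_degreeLT_of_coeff_eq_zero (sub_mem (Submodule.smul_mem _ _ hq.mem_degreeLT)
      hp.mem_degreeLT) ?_
    have : (b : ℂ) ≠ 0 := by exact_mod_cast hb.ne'
    rw [coeff_sub, coeff_smul, hpa, hqb, smul_eq_mul]
    push_cast
    field_simp
    ring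
  · rw [circInner_smul_left, ← circInner_conj_symm,
      circInner_eq_zero_of_mem_degreeLT hq.orthogonal hw]
    simp
  · rw [circInner_smul_left, circInner_smul_right, hq.norm_one, Complex.conj_ofReal, mul_one,
      ← Complex.ofReal_mul, Complex.ofReal_re, eval_smul, norm_smul, Complex.norm_real, mul_pow,
      Real.norm_eq_abs, sq_abs, mul_comm, ← sq]
    exact mul_le_mul_of_nonneg_right (pow_le_pow_left₀ (norm_nonneg _) hle 2) (sq_nonneg _)

/-- First order optimality of a maximizer `μ`, in the direction of `σ`. -/
theorem first_variation_nonneg {n : ℕ} {δ : ℝ} (hδ : 0 < δ) {μ σ : Measure UnitCirc}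
    (hμ : μ ∈ steklovClass δ) (hσ : σ ∈ steklovClass δ)
    (hmax : IsMaxOn (fun σ : Measure UnitCirc => ‖(orthonormalPoly σ n).eval 1‖)
      (steklovClass δ) μ)
    {p a : ℂ[X]} (hpμ : orthonormalPoly μ n = p) (ha : a ∈ degreeLT ℂ n)
    (hrep : ∀ w ∈ degreeLT ℂ n, circInner μ w a = w.eval 1) :
    0 ≤ ‖p.eval 1‖ ^ 2 * (circInner σ p p - circInner μ p p).re +
      2 * (conj (p.eval 1) * (circInner σ p a - circInner μ p a)).re := by
  have hμ' := hμ
  have hσ' := hσ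
  obtain ⟨_, hμc⟩ := mem_steklovClass_iff.1 hμ
  obtain ⟨_, -⟩ := mem_steklovClass_iff.1 hσ
  have hc : ENNReal.ofReal (δ / (2 * π)) ≠ 0 := by simpa using by positivity
  have hp := isOrthonormalPoly_orthonormalPoly hc hμc n
  obtain ⟨C, hC, hsup⟩ := exists_norm_eval_sq_le hc hμc (n + 1)
  have hsup' (q : ℂ[X]) (hq : q ∈ degreeLT ℂ (n + 1)) (θ : UnitCirc) :
      ‖q.eval (AddCircle.toCircle θ : ℂ)‖ ≤ √(C * (circInner μ q q).re) :=
    Real.le_sqrt_of_sq_le (hsup q hq θ)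
  have hn1 : degreeLT ℂ n ≤ degreeLT ℂ (n + 1) := degreeLT_mono n.le_succ
  have hpn := hp.mem_degreeLT
  have hpp := hp.norm_one
  have hpw (w) (hw : w ∈ degreeLT ℂ n) : circInner μ w p = 0 :=
    hpμ ▸ circInner_eq_zero_of_mem_degreeLT hp.orthogonal hw
  have hwp (w) (hw : w ∈ degreeLT ℂ n) : circInner μ p w = 0 := by
    rw [← circInner_conj_symm, hpw w hw, map_zero]
  have hpsup := hsup' _ hpn
  have hasup := hsup' a (hn1 ha)
  have hex (t : ℝ) (h0 : 0 < t) (h1 : t < 1) := exists_rescaled_orthonormalPoly hδ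
    (steklovClass_convex_comb h0.le h1.le hμ hσ) hmax hp
  rw [hpμ] at hpn hpp hex hpsup
  set T : ℂ[X] → ℂ[X] → ℂ := fun x y => circInner σ x y - circInner μ x y with hT
  have hTadd (x y z : ℂ[X]) : T (x + y) z = T x z + T y z := by
    simp only [hT, circInner_add_left]; ring
  have hTle {x y : ℂ[X]} {A B : ℝ}
      (hx : ∀ θ : UnitCirc, ‖x.eval (AddCircle.toCircle θ : ℂ)‖ ≤ A)
      (hy : ∀ θ : UnitCirc, ‖y.eval (AddCircle.toCircle θ : ℂ)‖ ≤ B) : ‖T x y‖ ≤ 2 * (A * B) :=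
    (norm_sub_le _ _).trans (by
      linarith [norm_circInner_le σ hx hy, norm_circInner_le μ hx hy])
  set b := √(C * (circInner μ p p).re)
  set A := √(C * (circInner μ a a).re)
  have hb0 : 0 ≤ b := Real.sqrt_nonneg _
  have hA0 : 0 ≤ A := Real.sqrt_nonneg _
  set E := ‖p.eval 1‖ ^ 2 * (T p p).re + 2 * (conj (p.eval 1) * T p a).re with hE
  set K := (‖p.eval 1‖ ^ 2 * (2 * b) + 2 * (‖p.eval 1‖ * (2 * A))) * (4 * C * b) with hK
  have key (t : ℝ) (h0 : 0 < t) (h1 : t < 1) (ht : 2 * C * t ≤ 1 / 2) : -(K * t) ≤ E := by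
    obtain ⟨P, hP, horth, hle⟩ := hex t h0 h1
    obtain ⟨d, rfl⟩ : ∃ d, P = p + d := ⟨P - p, by ring⟩
    rw [add_sub_cancel_left] at hP
    have hcc (x y : ℂ[X]) : circInner (ENNReal.ofReal (1 - t) • μ + ENNReal.ofReal t • σ) x y
        = circInner μ x y + t * T x y := by
      rw [circInner_convex_comb μ σ h0.le h1.le]; simp only [hT]; ring
    simp only [hcc] at horth hle
    have hortho (w) (hw : w ∈ degreeLT ℂ n) : circInner μ d w = -(t * T (p + d) w) := by
      have := horth w hw
      rw [circInner_add_left, hwp w hw, zero_add] at this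
      linear_combination this
    set s := √(C * (circInner μ d d).re) with hs
    have hs0 : 0 ≤ s := Real.sqrt_nonneg _
    have hdsup := hsup' d (hn1 hP)
    have hPsup (θ : UnitCirc) : ‖(p + d).eval (AddCircle.toCircle θ : ℂ)‖ ≤ b + s := by
      rw [eval_add]; exact (norm_add_le _ _).trans (add_le_add (hpsup θ) (hdsup θ))
    have hs1 : s * s ≤ C * (t * (2 * ((b + s) * s))) := by
      rw [Real.mul_self_sqrt (mul_nonneg hC (circInner_self_re_nonneg μ d))]
      gcongr
      calc (circInner μ d d).re ≤ ‖circInner μ d d‖ := Complex.re_le_norm _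
        _ = t * ‖T (p + d) d‖ := by
          rw [hortho d hP, norm_neg, norm_mul, Complex.norm_real, Real.norm_of_nonneg h0.le]
        _ ≤ _ := by gcongr; exact hTle hPsup hdsup
    -- The perturbation `d` is `O(t)`: cancel one `s` in `hs1`, then absorb the `s` on the right
    -- using `2 * C * t ≤ 1 / 2`.
    have hs2 : s ≤ 4 * C * b * t := by
      rcases hs0.eq_or_lt with h | h
      · rw [← h]; positivity
      · have : s ≤ 2 * C * t * (b + s) := le_of_mul_le_mul_right (by linarith) h
        nlinarith
    have hev : (p + d).eval 1 = p.eval 1 - t * T (p + d) a := by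
      rw [eval_add, ← hrep d hP, hortho a ha]; ring
    -- The left side is the squared norm of `P = p + d` in the mixed measure; `P` is orthogonal
    -- there to `d`, so only its product with `p` remains.
    have hnorm : circInner μ (p + d) (p + d) + t * T (p + d) (p + d) = 1 + t * T (p + d) p := by
      have h2 := horth d hP
      have h3 : T (p + d) (p + d) = T (p + d) p + T (p + d) d := by
        simp only [hT, circInner_add_right]; ring
      rw [circInner_add_right, h3, circInner_add_left _ p d p, hpp, hpw d hP]
      linear_combination h2
    rw [hev, hnorm, ← Complex.normSq_eq_norm_sq, Complex.normSq_sub, Complex.normSq_eq_norm_sq,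
      Complex.normSq_eq_norm_sq] at hle
    have h4 : 0 ≤ t * (‖p.eval 1‖ ^ 2 * (T (p + d) p).re
        + 2 * (conj (p.eval 1) * T (p + d) a).re) := by
      have h5 : (p.eval 1 * conj (t * T (p + d) a)).re = t * (conj (p.eval 1) * T (p + d) a).re := by
        simp; ring
      have h6 : (1 + t * T (p + d) p).re = 1 + t * (T (p + d) p).re := by simp
      rw [h5, h6] at hle
      nlinarith [sq_nonneg ‖t * T (p + d) a‖]
    -- After division by `t`, replacing `p + d` by `p` inside `T` costs at most `K * t`.
    have h7 := nonneg_of_mul_nonneg_right h4 h0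
    rw [hTadd, hTadd, mul_add (conj _), Complex.add_re, Complex.add_re] at h7
    have h8 : (T d p).re ≤ 2 * (s * b) := (Complex.re_le_norm _).trans (hTle hdsup hpsup)
    have h9 : (conj (p.eval 1) * T d a).re ≤ ‖p.eval 1‖ * (2 * (s * A)) := by
      refine (Complex.re_le_norm _).trans ?_
      rw [norm_mul, RCLike.norm_conj]
      gcongr
      exact hTle hdsup hasup
    have h10 : ‖p.eval 1‖ ^ 2 * (T d p).re ≤ ‖p.eval 1‖ ^ 2 * (2 * (s * b)) := by gcongr
    have h11 : (‖p.eval 1‖ ^ 2 * (2 * b) + 2 * (‖p.eval 1‖ * (2 * A))) * s ≤ K * t := by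
      rw [hK, mul_assoc _ _ t]; gcongr
    linarith
  have hlim : Filter.Tendsto (fun t : ℝ => -(K * t)) (nhdsWithin 0 (Set.Ioi 0)) (nhds 0) := by
    have : Continuous fun t : ℝ => -(K * t) := by fun_prop
    simpa using (this.tendsto 0).mono_left nhdsWithin_le_nhds
  refine le_of_tendsto hlim ?_
  have h1 : ∀ᶠ t : ℝ in nhdsWithin 0 (Set.Ioi 0), t < 1 :=
    nhdsWithin_le_nhds (Iio_mem_nhds one_pos)
  have h2 : ∀ᶠ t : ℝ in nhdsWithin 0 (Set.Ioi 0), 2 * C * t < 1 / 2 := by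
    have : Continuous fun t : ℝ => 2 * C * t := by fun_prop
    exact nhdsWithin_le_nhds ((this.tendsto 0).eventually_lt_const (by norm_num))
  filter_upwards [self_mem_nhdsWithin, h1, h2] with t h0 h1 h2
  exact key t h0 h1 h2.le

/-! ### Zeros of nonnegative trigonometric polynomials. -/

theorem card_le_of_double_roots {P : ℂ[X]} {n : ℕ} (hP : P ≠ 0) (hd : P.natDegree ≤ n + n)
    (s : Finset ℂ) (hs : ∀ z ∈ s, P.IsRoot z ∧ P.derivative.IsRoot z) : s.card ≤ n := by
  have h : 2 • s.val ≤ P.roots := by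
    refine Multiset.le_iff_count.2 fun z => ?_
    rw [Multiset.count_nsmul, count_roots]
    by_cases hz : z ∈ s
    · rw [Multiset.count_eq_one_of_mem s.nodup hz]
      exact (one_lt_rootMultiplicity_iff_isRoot hP).2 (hs z hz)
    · rw [Multiset.count_eq_zero_of_notMem hz]; simp
  have := (Multiset.card_le_card h).trans (card_roots' P)
  rw [Multiset.card_nsmul] at this
  change 2 * s.card ≤ _ at this
  omega

/-- A real trigonometric polynomial `z⁻ⁿ P(z)` that is nonnegative on the circle has only multiple
zeros there. -/
theorem derivative_isRoot_of_nonneg {P : ℂ[X]} {n : ℕ} {g : Circle → ℝ} (hg : ∀ z, 0 ≤ g z)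
    (hP : ∀ z : Circle, P.eval (z : ℂ) = (z : ℂ) ^ n * g z) {z : Circle} (hz : g z = 0) :
    P.IsRoot z ∧ P.derivative.IsRoot z := by
  have hroot : P.eval (z : ℂ) = 0 := by rw [hP, hz]; simp
  refine ⟨hroot, ?_⟩
  set x₀ := Complex.arg z
  have hz0 : Circle.exp x₀ = z := Circle.exp_arg z
  set G : ℝ → ℂ := fun x => P.eval (Complex.exp (x * Complex.I)) * Complex.exp (-(n * (x * Complex.I)))
  have hG (x : ℝ) : G x = g (Circle.exp x) := by
    have := hP (Circle.exp x)
    rw [Circle.coe_exp] at this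
    simp only [G, this, ← Complex.exp_nat_mul, mul_right_comm _ (g _ : ℂ), ← Complex.exp_add]
    simp
  have h1 : HasDerivAt (fun x : ℝ => (x : ℂ) * Complex.I) Complex.I x₀ := by
    simpa using (Complex.ofRealCLM.hasDerivAt (x := x₀)).mul_const Complex.I
  have hzc : Complex.exp (x₀ * Complex.I) = z := by rw [← Circle.coe_exp, hz0]
  have h2 := (P.hasDerivAt (Complex.exp (x₀ * Complex.I))).comp x₀ h1.cexp
  have h3 := h2.mul (h1.const_mul (n : ℂ)).neg.cexp
  simp only [Function.comp_apply, hzc, hroot, zero_mul, add_zero] at h3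
  set D := P.derivative.eval (z : ℂ) * (z * Complex.I) * Complex.exp (-(n * (x₀ * Complex.I)))
  have h4 : HasDerivAt G D x₀ := h3
  have hre : HasDerivAt (fun x => g (Circle.exp x)) D.re x₀ := by
    have := Complex.reCLM.hasFDerivAt.comp_hasDerivAt x₀ h4
    refine (this.congr_of_eventuallyEq (.of_forall fun x => ?_))
    simp [hG]
  have him : HasDerivAt (fun _ : ℝ => (0 : ℝ)) D.im x₀ := by
    have := Complex.imCLM.hasFDerivAt.comp_hasDerivAt x₀ h4
    refine (this.congr_of_eventuallyEq (.of_forall fun x => ?_))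
    simp [hG]
  have hmin : IsLocalMin (fun x => g (Circle.exp x)) x₀ :=
    .of_forall fun x => by simp only [hz0, hz]; exact hg _
  -- The real part of the derivative vanishes at a minimum; the imaginary part vanishes because `G`
  -- is real-valued.
  have hD : D = 0 := Complex.ext (hmin.hasDerivAt_eq_zero hre) (him.unique (hasDerivAt_const _ _))
  simpa [D, Complex.exp_ne_zero] using hD

/-- Since `conj z = z⁻¹` on the circle, this makes `zⁿ|Q|²` a polynomial in `z`. -/
theorem eval_reflect_map_conj {Q : ℂ[X]} {n : ℕ} (hQ : Q.natDegree ≤ n) (z : Circle) :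
    (reflect n (Q.map (starRingEnd ℂ))).eval (z : ℂ) = (z : ℂ) ^ n * conj (Q.eval (z : ℂ)) := by
  let := invertibleOfNonzero (inv_ne_zero (Circle.coe_ne_zero z))
  have h := eval₂_reflect_mul_pow (RingHom.id ℂ) (z : ℂ)⁻¹ n (Q.map (starRingEnd ℂ))
    (by rwa [natDegree_map])
  rw [invOf_eq_inv, inv_inv] at h
  change eval _ _ * _ = eval _ _ at h
  rw [← Circle.coe_inv, Circle.coe_inv_eq_conj, eval_map_apply] at h
  rw [← h, mul_comm, mul_assoc, ← mul_pow, ← Circle.coe_inv_eq_conj, Circle.coe_inv]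
  simp

/-- Multiplying the difference from the minimum by `zⁿ` gives a polynomial of degree at most `2n`
with a double root at each minimizer. -/
theorem card_minimizers_le {n : ℕ} (hn : 1 ≤ n) {Q a : ℂ[X]} {m : ℝ} (hQ : Q.natDegree ≤ n)
    (ha : a ∈ degreeLT ℂ n) (hQn : Q.coeff n ≠ 0) (hQ0 : Q.coeff 0 ≠ 0)
    (hm : ∀ z : Circle, m ≤ ‖Q.eval (z : ℂ)‖ ^ 2 - ‖a.eval (z : ℂ)‖ ^ 2)
    (s : Finset Circle)
    (hs : ∀ z ∈ s, ‖Q.eval (z : ℂ)‖ ^ 2 - ‖a.eval (z : ℂ)‖ ^ 2 = m) : s.card ≤ n := by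
  have hacoeff : ∀ k, n ≤ k → a.coeff k = 0 := by
    rwa [mem_degreeLT, degree_lt_iff_coeff_zero] at ha
  have han : a.natDegree ≤ n := natDegree_le_iff_coeff_eq_zero.2 fun k hk => hacoeff k hk.le
  have hr {q : ℂ[X]} (hq : q.natDegree ≤ n) :
      (reflect n (q.map (starRingEnd ℂ))).natDegree ≤ n := by
    refine natDegree_le_iff_coeff_eq_zero.2 fun k hk => ?_
    rw [coeff_reflect, revAt_eq_self_of_lt hk, coeff_map,
      coeff_eq_zero_of_natDegree_lt (hq.trans_lt hk), map_zero]
  obtain ⟨P, hPdef⟩ : ∃ P : ℂ[X], P = Q * reflect n (Q.map (starRingEnd ℂ)) -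
    a * reflect n (a.map (starRingEnd ℂ)) - C (m : ℂ) * X ^ n := ⟨_, rfl⟩
  have hPd : P.natDegree ≤ n + n := by
    rw [hPdef]
    refine (natDegree_sub_le _ _).trans (max_le ((natDegree_sub_le _ _).trans (max_le ?_ ?_)) ?_)
    · exact natDegree_mul_le_of_le hQ (hr hQ)
    · exact natDegree_mul_le_of_le han (hr han)
    · exact (natDegree_C_mul_X_pow_le _ _).trans (by omega)
  have hP0 : P ≠ 0 := by
    intro h
    -- Neither `a`, of degree less than `n`, nor `m zⁿ`, as `n ≥ 1`, reaches order `2n`.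
    have h1 : P.coeff (n + n) = Q.coeff n * conj (Q.coeff 0) := by
      rw [hPdef, coeff_sub, coeff_sub, coeff_mul_add_eq_of_natDegree_le hQ (hr hQ),
        coeff_mul_add_eq_of_natDegree_le han (hr han), hacoeff n le_rfl, coeff_C_mul, coeff_X_pow,
        if_neg (by omega), coeff_reflect, revAt_le le_rfl, coeff_map, Nat.sub_self]
      ring
    rw [h, coeff_zero] at h1
    simp [hQn, hQ0] at h1
  have hPe (z : Circle) : P.eval (z : ℂ) = (z : ℂ) ^ n *
      ((‖Q.eval (z : ℂ)‖ ^ 2 - ‖a.eval (z : ℂ)‖ ^ 2 - m : ℝ) : ℂ) := by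
    simp only [hPdef, eval_sub, eval_mul, eval_C, eval_pow, eval_X, eval_reflect_map_conj hQ,
      eval_reflect_map_conj han]
    push_cast
    rw [← Complex.mul_conj', ← Complex.mul_conj']
    ring
  rw [← Finset.card_map (⟨fun z => (z : ℂ), fun _ _ h => Circle.ext h⟩ : Circle ↪ ℂ)]
  refine card_le_of_double_roots hP0 hPd _ fun z hz => ?_
  obtain ⟨z, hzs, rfl⟩ := Finset.mem_map.1 hz
  exact derivative_isRoot_of_nonneg (fun z => sub_nonneg.2 (hm z)) hPe
    (by rw [hs z hzs, sub_self])

/-! ### The reproducing kernel at 1. -/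

theorem Polynomial.mem_degreeLT_of_natDegree_lt {p : ℂ[X]} {n : ℕ} (h : p.natDegree < n) :
    p ∈ degreeLT ℂ n :=
  mem_degreeLT.2 (degree_le_natDegree.trans_lt (by exact_mod_cast h))

/-- `Q` reproduces the value at `1` of the polynomials of degree at most `n`. -/
theorem circInner_reproducing {μ : Measure UnitCirc} [IsFiniteMeasure μ] {n : ℕ} {p a : ℂ[X]}
    (hp : IsOrthonormalPoly μ n p) (ha : a ∈ degreeLT ℂ n)
    (hrep : ∀ w ∈ degreeLT ℂ n, circInner μ w a = w.eval 1) {f : ℂ[X]}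
    (hf : f ∈ degreeLT ℂ (n + 1)) : circInner μ f (conj (p.eval 1) • p + a) = f.eval 1 := by
  obtain ⟨c, hc, hpc⟩ := hp.coeff_eq
  have hc0 : (c : ℂ) ≠ 0 := by exact_mod_cast hc.ne'
  obtain ⟨b, w, hw, rfl⟩ : ∃ b : ℂ, ∃ w ∈ degreeLT ℂ n, f = b • p + w := by
    refine ⟨f.coeff n / c, f - (f.coeff n / c) • p, mem_degreeLT_of_coeff_eq_zero
      (sub_mem hf (Submodule.smul_mem _ _ hp.mem_degreeLT)) ?_, by ring⟩
    rw [coeff_sub, coeff_smul, hpc, smul_eq_mul]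
    field_simp
    ring
  have hwp := circInner_eq_zero_of_mem_degreeLT hp.orthogonal hw
  have hpa : circInner μ p a = 0 := by
    rw [← circInner_conj_symm, circInner_eq_zero_of_mem_degreeLT hp.orthogonal ha, map_zero]
  simp only [circInner_add_left, circInner_add_right, circInner_smul_left, circInner_smul_right,
    hwp, hpa, hp.norm_one, hrep w hw, eval_add, eval_smul, smul_eq_mul, Complex.conj_conj]
  ring

theorem coeff_zero_ne_zero_of_reproducing {μ : Measure UnitCirc} [IsFiniteMeasure μ]
    {c : ENNReal} (hc : c ≠ 0) (hμ : c • (volume : Measure UnitCirc) ≤ μ) {n : ℕ} {Q : ℂ[X]}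
    (hQ : Q.natDegree ≤ n) (hQ0 : Q ≠ 0)
    (hrep : ∀ f ∈ degreeLT ℂ (n + 1), circInner μ f Q = f.eval 1) : Q.coeff 0 ≠ 0 := by
  intro h
  obtain ⟨r, hr⟩ := X_dvd_iff.2 h
  have hr0 : r ≠ 0 := by rintro rfl; exact hQ0 (by rw [hr, mul_zero])
  -- If `Q = X r`, then `(z - 1) r · conj Q` has real part `(1 - Re z)|r|²` on the circle, and its
  -- integral is the value of `(X - 1) r` at 1, namely 0.
  refine hr0 (eq_zero_of_circInner_eq_zero hc hμ (p := (X - C 1) * r) (q := Q)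
    (fun z => ?_) ?_)
  · have hz : (z : ℂ).re * (z : ℂ).re + (z : ℂ).im * (z : ℂ).im = 1 := by
      rw [← Complex.normSq_apply, Complex.normSq_eq_norm_sq, Circle.norm_coe, one_pow]
    simp only [hr, eval_mul, eval_sub, eval_X, map_mul,
      ← Complex.normSq_eq_norm_sq, Complex.normSq_apply]
    simp
    linear_combination ((eval (z : ℂ) r).re ^ 2 + (eval (z : ℂ) r).im ^ 2) * hz
  · rw [hrep]
    · simp
    · have h1 := natDegree_mul (X_sub_C_ne_zero (1 : ℂ)) hr0
      rw [natDegree_X_sub_C] at h1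
      have h2 := natDegree_mul (X_ne_zero (R := ℂ)) hr0
      rw [natDegree_X, ← hr] at h2
      exact mem_degreeLT_of_natDegree_lt (by omega)

/-! ### Atomic measures and the conclusion. -/

/-- A measure carried by a finite nonempty set of the circle, written with ordered angles. -/
theorem exists_eq_sum_dirac {ν : Measure UnitCirc} [IsFiniteMeasure ν] (s : Finset UnitCirc)
    (hs : ∀ᵐ θ ∂ν, θ ∈ s) :
    ∃ (m : Fin s.card → ℝ) (θ : Fin s.card → ℝ),
      (∀ j, 0 ≤ m j) ∧ StrictMono θ ∧ (∀ j, θ j ∈ Set.Ioc (-π) π) ∧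
      ν = ∑ j, ENNReal.ofReal (m j) • Measure.dirac ((θ j : ℝ) : UnitCirc) := by
  classical
  have hν : ν = ∑ z ∈ s, ν {z} • Measure.dirac z := by
    ext t ht
    have h1 : ν t = ν (t ∩ s) := measure_congr (by
      filter_upwards [hs] with θ hθ
      exact propext ⟨fun h => ⟨h, hθ⟩, fun h => h.1⟩)
    have h2 : t ∩ (s : Set UnitCirc) = (s.filter (· ∈ t) : Finset UnitCirc) := by
      ext; simp [and_comm]
    rw [h1, h2, ← sum_measure_singleton, Finset.sum_filter, Measure.finsetSum_apply]
    refine Finset.sum_congr rfl fun z _ => ?_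
    simp [Measure.dirac_apply' z ht, Set.indicator_apply]
  set f : UnitCirc → ℝ := fun z => (AddCircle.equivIoc (2 * π) (-π) z : ℝ) with hf
  have hfc (z : UnitCirc) : ((f z : ℝ) : UnitCirc) = z :=
    (AddCircle.equivIoc (2 * π) (-π)).symm_apply_apply z
  have hfi : Function.Injective f := Function.LeftInverse.injective hfc
  have hcard : (s.image f).card = s.card := Finset.card_image_of_injective s hfi
  set e := (s.image f).orderIsoOfFin hcard
  refine ⟨fun j => (ν {((e j : ℝ) : UnitCirc)}).toReal, fun j => e j,
    fun j => ENNReal.toReal_nonneg, fun i j h => e.strictMono h, fun j => ?_, ?_⟩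
  · obtain ⟨z, -, hz⟩ := Finset.mem_image.1 (e j).2
    change ((e j : ℝ)) ∈ _
    rw [← hz]
    have := (AddCircle.equivIoc (2 * π) (-π) z).2
    exact ⟨this.1, this.2.trans_eq (by ring)⟩
  · simp only [ENNReal.ofReal_toReal (measure_ne_top ν _)]
    refine Eq.trans ?_ (e.toEquiv.sum_comp (fun x : s.image f => ν {((x : ℝ) : UnitCirc)} •
      Measure.dirac ((x : ℝ) : UnitCirc))).symm
    rw [Finset.sum_coe_sort (s.image f) (fun x : ℝ => ν {(x : UnitCirc)} •
      Measure.dirac (x : UnitCirc)), Finset.sum_image fun x _ y _ h => hfi h]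
    simp only [hfc]
    exact hν

theorem volume_smul_univ {δ : ℝ} :
    (ENNReal.ofReal (δ / (2 * π)) • (volume : Measure UnitCirc)) Set.univ = ENNReal.ofReal δ := by
  rw [Measure.smul_apply, AddCircle.measure_univ, smul_eq_mul,
    ← ENNReal.ofReal_mul' Real.two_pi_pos.le, div_mul_cancel₀ _ Real.two_pi_pos.ne']

theorem mainTheorem3 (n : ℕ) (hn : 1 ≤ n) (δ : ℝ) (hδ : 0 < δ)
    (μ : Measure UnitCirc) (hμ : μ ∈ steklovClass δ)
    (hmax : IsMaxOn (fun σ : Measure UnitCirc => ‖(orthonormalPoly σ n).eval 1‖)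
      (steklovClass δ) μ) :
    ∃ N : ℕ, 1 ≤ N ∧ N ≤ n ∧ ∃ (m : Fin N → ℝ) (θ : Fin N → ℝ),
      (∀ j, 0 ≤ m j) ∧ StrictMono θ ∧ (∀ j, θ j ∈ Set.Ioc (-π) π) ∧
      μ = ENNReal.ofReal (δ / (2 * π)) • (volume : Measure UnitCirc) +
        ∑ j : Fin N, ENNReal.ofReal (m j) • Measure.dirac ((θ j : ℝ) : UnitCirc) := by
  obtain ⟨_, hμc⟩ := mem_steklovClass_iff.1 hμ
  have hc : ENNReal.ofReal (δ / (2 * π)) ≠ 0 := by simpa using by positivity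
  obtain ⟨a, ha, hrep⟩ := exists_circInner_representer hc hμc n (leval 1)
  simp only [leval_apply] at hrep
  have hp := isOrthonormalPoly_orthonormalPoly hc hμc n
  have hvar {σ : Measure UnitCirc} (hσ : σ ∈ steklovClass δ) :=
    first_variation_nonneg hδ hμ hσ hmax rfl ha hrep
  set p := orthonormalPoly μ n
  set τ := ENNReal.ofReal (δ / (2 * π)) • (volume : Measure UnitCirc)
  have hp1 : p.eval 1 ≠ 0 := hp.eval_one_ne_zero hc hμc
  set Q := conj (p.eval 1) • p + a with hQ
  have hQmem : Q ∈ degreeLT ℂ (n + 1) :=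
    add_mem (Submodule.smul_mem _ _ hp.mem_degreeLT) (degreeLT_mono n.le_succ ha)
  have hQn : Q.natDegree ≤ n := by
    rw [mem_degreeLT, degree_lt_iff_coeff_zero] at hQmem
    exact natDegree_le_iff_coeff_eq_zero.2 fun k hk => hQmem k hk
  have hQc : Q.coeff n ≠ 0 := by
    obtain ⟨b, hb, hpb⟩ := hp.coeff_eq
    rw [mem_degreeLT, degree_lt_iff_coeff_zero] at ha
    simp [hQ, ha n le_rfl, hpb, hp1, hb.ne']
  have hQ0 : Q.coeff 0 ≠ 0 := coeff_zero_ne_zero_of_reproducing hc hμc hQn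
    (by rintro h; simp [h] at hQc) fun f hf => circInner_reproducing hp ha hrep hf
  set U : UnitCirc → ℝ := fun θ =>
    ‖Q.eval (AddCircle.toCircle θ : ℂ)‖ ^ 2 - ‖a.eval (AddCircle.toCircle θ : ℂ)‖ ^ 2 with hU
  have hQc2 := (continuous_eval_toCircle Q).norm.pow 2
  have hac2 := (continuous_eval_toCircle a).norm.pow 2
  have hUc : Continuous U := hQc2.sub hac2
  -- Expanding `|Q|²` cancels `|a|²`, leaving exactly the functional of the first variation.
  have hUi (σ : Measure UnitCirc) [IsFiniteMeasure σ] : ∫ θ, U θ ∂σ =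
      ‖p.eval 1‖ ^ 2 * (circInner σ p p).re + 2 * (conj (p.eval 1) * circInner σ p a).re := by
    refine (integral_sub (hQc2.integrable_unitCirc σ) (hac2.integrable_unitCirc σ)).trans ?_
    simp only [Pi.pow_apply]
    rw [← circInner_self_re, ← circInner_self_re]
    simp only [hQ, circInner_add_left, circInner_add_right, circInner_smul_left,
      circInner_smul_right, ← circInner_conj_symm σ p a, ← Complex.normSq_eq_norm_sq,
      Complex.normSq_apply]
    rw [circInner_self_eq_re σ p]
    simp
    ring
  have hmin {σ : Measure UnitCirc} (hσ : σ ∈ steklovClass δ) : ∫ θ, U θ ∂μ ≤ ∫ θ, U θ ∂σ := by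
    obtain ⟨_, -⟩ := mem_steklovClass_iff.1 hσ
    have := hvar hσ
    rw [mul_sub, Complex.sub_re, Complex.sub_re] at this
    rw [hUi, hUi]
    linarith
  obtain ⟨θ₀, -, hθ₀⟩ := isCompact_univ.exists_isMinOn Set.univ_nonempty hUc.continuousOn
  replace hθ₀ (θ : UnitCirc) : U θ₀ ≤ U θ := hθ₀ (Set.mem_univ θ)
  have : IsFiniteMeasure τ := isFiniteMeasure_of_le μ hμc
  set ν := μ - τ
  have hνμ : ν + τ = μ := Measure.sub_add_cancel_of_le hμc
  have hνuniv : ν Set.univ + ENNReal.ofReal δ = 1 := by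
    rw [← volume_smul_univ, ← Measure.add_apply, hνμ, measure_univ]
  -- The competitor concentrates the whole mass of `ν` at a minimizer of `U`.
  have hσ : ν Set.univ • Measure.dirac θ₀ + τ ∈ steklovClass δ := by
    refine mem_steklovClass_iff.2 ⟨⟨?_⟩, Measure.le_add_left le_rfl⟩
    rw [Measure.add_apply, volume_smul_univ, ← hνuniv]
    simp
  have hle := hmin hσ
  clear_value τ
  rw [← hνμ, integral_add_measure (hUc.integrable_unitCirc _) (hUc.integrable_unitCirc _),
    integral_add_measure ((hUc.integrable_unitCirc _).smul_measure (measure_ne_top ν _))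
      (hUc.integrable_unitCirc _), integral_smul_measure, integral_dirac] at hle
  have hae : ∀ᵐ θ ∂ν, U θ = U θ₀ := by
    have h0 : ∫ θ, (U θ - U θ₀) ∂ν = 0 := by
      refine le_antisymm ?_ (integral_nonneg fun θ => sub_nonneg.2 (hθ₀ θ))
      rw [integral_sub (hUc.integrable_unitCirc _) (integrable_const _), integral_const,
        Measure.real]
      linarith
    rw [integral_eq_zero_iff_of_nonneg (fun θ => sub_nonneg.2 (hθ₀ θ))
      ((hUc.sub continuous_const).integrable_unitCirc _)] at h0
    filter_upwards [h0] with θ hθ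
    exact sub_eq_zero.1 hθ
  have hinj := AddCircle.injective_toCircle (T := 2 * π) Real.two_pi_pos.ne'
  have hsurj (z : Circle) : ∃ θ : UnitCirc, AddCircle.toCircle θ = z := by
    obtain ⟨θ, h⟩ := (AddCircle.homeomorphCircle Real.two_pi_pos.ne').surjective z
    exact ⟨θ, by rw [← h, AddCircle.homeomorphCircle_apply]⟩
  have hcard (s : Finset UnitCirc) (hs : ∀ θ ∈ s, U θ = U θ₀) : s.card ≤ n := by
    rw [← Finset.card_map ⟨_, hinj⟩]
    refine card_minimizers_le hn hQn ha hQc hQ0 (m := U θ₀) (fun z => ?_) _ fun z hz => ?_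
    · obtain ⟨θ, rfl⟩ := hsurj z
      exact hθ₀ θ
    · obtain ⟨θ, hθ, rfl⟩ := Finset.mem_map.1 hz
      exact hs θ hθ
  have hfin : {θ | U θ = U θ₀}.Finite := by
    by_contra h
    obtain ⟨s, hs, hsn⟩ := Set.Infinite.exists_subset_card_eq h (n + 1)
    have := hcard s fun θ hθ => hs hθ
    omega
  obtain ⟨m, θ, h1, h2, h3, h4⟩ := exists_eq_sum_dirac hfin.toFinset (by simpa using hae)
  -- The sum runs over all minimizers of `U`, some perhaps of zero mass; so `N ≥ 1` even when `ν =
  -- 0`.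
  refine ⟨hfin.toFinset.card, Finset.card_pos.2 ⟨θ₀, by simp⟩, hcard _ (by simp), m, θ, h1, h2,
    h3, ?_⟩
  rw [← h4, add_comm, hνμ]
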